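/- Let $\mathbb K\in\{\mathbb R,\mathbb C\}$, let $n\ge 0$, and let $H_0,\dots,H_n$ be Hilbert spaces over $\mathbb K$; put $H_p=0$ for $p<0$ and for $p\ge n+1$. For a sequence $\delta=(\delta_p)_{p\in\mathbb Z}$ of bounded linear operators $\delta_p\colon H_p\to H_{p-1}$ (so that $\delta_p=0$ for $p\le 0$ and $p\ge n+1$), write $N(\cdot)$ and $R(\cdot)$ for null space and range. The sequence $$0\to H_n\xrightarrow{\delta_n}H_{n-1}\to\cdots\to H_1\xrightarrow{\delta_1}H_0\to 0$$ is called a Fredholm chain $(H,\delta)$ if for every $p=0,\dots,n$ the quotients $$N(\delta_p)/\bigl(N(\delta_p)\cap R(\delta_{p+1})\bigr)\quad\text{and}\quad R(\delta_{p+1})/\bigl(N(\delta_p)\cap R(\delta_{p+1})\bigr)$$ are finite dimensional, and then its index is $$\operatorname{ind}(H,\delta)=\sum_{p=0}^n(-1)^p\Bigl(\dim N(\delta_p)/\bigl(N(\delta_p)\cap R(\delta_{p+1})\bigr)-\dim R(\delta_{p+1})/\bigl(N(\delta_p)\cap R(\delta_{p+1})\bigr)\Bigr).$$ Theorem 6.6.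 Let $(H,\delta)$ be a Fredholm chain and, for each $p\in\mathbb Z$, let $k_p\colon H_p\to H_{p-1}$ be a compact operator. Put $\delta'_p=\delta_p+k_p$ and suppose that $R(\delta'_p\delta'_{p+1})$ is finite dimensional for each $p\in\mathbb Z$. Then $(H,\delta')$ is a Fredholm chain, and $$\operatorname{ind}(H,\delta)=\operatorname{ind}(H,\delta').$$ -/

import Mathlib

/-!
Finite sequences `0 → H_n → ⋯ → H_1 → H_0 → 0` of Hilbert spaces and bounded operators.
The spaces are a family `H : ℕ → Type*` with `H p = 0` for `p > n`, and
`δ p : H (p + 1) →L[𝕜] H p` is the operator with source `H (p + 1)`, usually written `δ_{p+1}`.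
The operator `δ_0 : H_0 → 0` is the zero map and is not part of the data.
-/

namespace HilbertChain

section

variable {𝕜 : Type*} [RCLike 𝕜] {H : ℕ → Type*}
  [∀ p, NormedAddCommGroup (H p)] [∀ p, InnerProductSpace 𝕜 (H p)]

/-- The null space `N(δ_p) ⊆ H_p`, where `δ_p : H_p → H_{p-1}`; since `δ_0 : H_0 → 0`, its null
space is all of `H_0`. -/
def nullSpace (δ : ∀ p, H (p + 1) →L[𝕜] H p) : ∀ p, Submodule 𝕜 (H p)
  | 0 => ⊤
  | p + 1 => LinearMap.ker (δ p : H (p + 1) →ₗ[𝕜] H p)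

/-- The range `R(δ_{p+1}) ⊆ H_p`, where `δ_{p+1} : H_{p+1} → H_p`. -/
def rangeSpace (δ : ∀ p, H (p + 1) →L[𝕜] H p) (p : ℕ) : Submodule 𝕜 (H p) :=
  LinearMap.range (δ p : H (p + 1) →ₗ[𝕜] H p)

/-- The quotient `N(δ_p) / (N(δ_p) ∩ R(δ_{p+1}))`. -/
abbrev NullQuotient (δ : ∀ p, H (p + 1) →L[𝕜] H p) (p : ℕ) :=
  nullSpace δ p ⧸ (nullSpace δ p ⊓ rangeSpace δ p).submoduleOf (nullSpace δ p)

/-- The quotient `R(δ_{p+1}) / (N(δ_p) ∩ R(δ_{p+1}))`. -/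
abbrev RangeQuotient (δ : ∀ p, H (p + 1) →L[𝕜] H p) (p : ℕ) :=
  rangeSpace δ p ⧸ (nullSpace δ p ⊓ rangeSpace δ p).submoduleOf (rangeSpace δ p)

/-- `0 → H_n → ⋯ → H_1 → H_0 → 0` is a Fredholm chain. -/
structure IsFredholmChain (n : ℕ) (δ : ∀ p, H (p + 1) →L[𝕜] H p) : Prop where
  subsingleton_of_lt : ∀ p, n < p → Subsingleton (H p)
  finite_nullQuotient : ∀ p ≤ n, FiniteDimensional 𝕜 (NullQuotient δ p)
  finite_rangeQuotient : ∀ p ≤ n, FiniteDimensional 𝕜 (RangeQuotient δ p)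

/-- The index of a Fredholm chain `0 → H_n → ⋯ → H_1 → H_0 → 0`. -/
noncomputable def index (n : ℕ) (δ : ∀ p, H (p + 1) →L[𝕜] H p) : ℤ :=
  ∑ p ∈ Finset.range (n + 1), (-1) ^ p *
    ((Module.finrank 𝕜 (NullQuotient δ p) : ℤ) - (Module.finrank 𝕜 (RangeQuotient δ p) : ℤ))

end

end HilbertChain

/-! ### Relative dimension of commensurable subspaces -/

/-! The index only involves the relative dimensions `relDim` of the commensurable subspaces N(δ_p)
and R(δ_{p+1}). Relative dimension is additive, so it can be compared along a sequence of changes of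
the operators.

Fold the chain into two operators a : E → F and b : F → E between the sums of its even and odd terms
(`isFredholmPair_fold`); the alternating sum becomes `pairIndex`. A finite rank change of a or b
moves its kernel and its range by opposite relative dimensions, hence preserves `pairIndex`
(`IsFredholmPair.of_finiteRange_sub`). As ab and ba have finite rank, such a change makes both
vanish (`exists_complex`). For a genuine complex, Hodge theory identifies `pairIndex` with the
Fredholm index of a + b* (`fredholm_add_adjoint`), which is stable under norm limits of finite rank
operators (`fredholm_add_of_approximable`). The original and the perturbed pair are joined through
their two complexes, whose difference is compact. -/

namespace Submodule

section RelRank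

open Cardinal

universe u v

variable {K : Type*} {V : Type u} {V' : Type v} [DivisionRing K] [AddCommGroup V] [Module K V]
  [AddCommGroup V'] [Module K V']

/-- The dimension of `A / (A ∩ B)`, realized as the image of `A` in the quotient by `B`. -/
noncomputable def relRank (A B : Submodule K V) : Cardinal :=
  Module.rank K (A.map B.mkQ)

lemma relRank_mono_left {A A' : Submodule K V} (h : A ≤ A') (B : Submodule K V) :
    relRank A B ≤ relRank A' B :=
  Submodule.rank_mono (Submodule.map_mono h)

lemma map_mkQ_eq_range (A B : Submodule K V) :
    A.map B.mkQ = LinearMap.range (B.mkQ ∘ₗ A.subtype) := by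
  rw [LinearMap.range_comp, Submodule.range_subtype]

/-- First isomorphism theorem; later computations of `relRank` exhibit a suitable `f`. -/
lemma relRank_eq_of_surjective {A B : Submodule K V} {W : Type v} [AddCommGroup W] [Module K W]
    (f : A →ₗ[K] W) (hf : Function.Surjective f) (hker : ∀ x : A, f x = 0 ↔ (x : V) ∈ B) :
    lift.{v} (relRank A B) = lift.{u} (Module.rank K W) := by
  have hk : LinearMap.ker f = LinearMap.ker (B.mkQ ∘ₗ A.subtype) := by
    ext x
    simp [hker x]
  unfold relRank
  rw [map_mkQ_eq_range]
  exact LinearEquiv.lift_rank_eq (((B.mkQ ∘ₗ A.subtype).quotKerEquivRange.symm.trans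
    (Submodule.quotEquivOfEq _ _ hk.symm)).trans (f.quotKerEquivOfSurjective hf))

lemma relRank_eq_rank_quotient (A B : Submodule K V) :
    relRank A B = Module.rank K (A ⧸ (A ⊓ B).submoduleOf A) := by
  have := relRank_eq_of_surjective (A := A) (B := B) ((A ⊓ B).submoduleOf A).mkQ
    (Submodule.mkQ_surjective _) (fun x => by
      rw [Submodule.mkQ_apply, Submodule.Quotient.mk_eq_zero]
      simp [Submodule.submoduleOf])
  simpa using this

lemma relRank_inf_left (A B : Submodule K V) : relRank A (A ⊓ B) = relRank A B := by
  rw [relRank_eq_rank_quotient A B, relRank_eq_rank_quotient, ← inf_assoc, inf_idem]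

lemma relRank_add_relRank {I J A : Submodule K V} (hIJ : I ≤ J) (hJA : J ≤ A) :
    relRank A I = relRank A J + relRank J I := by
  let f : A.map I.mkQ →ₗ[K] V ⧸ J := (Submodule.factor hIJ).domRestrict _
  have hr : LinearMap.range f = A.map J.mkQ := by
    rw [LinearMap.range_domRestrict, ← Submodule.map_comp]
    rfl
  have hk : (LinearMap.ker f).map (A.map I.mkQ).subtype = J.map I.mkQ := by
    ext y
    constructor
    · rintro ⟨⟨_, x, hx, rfl⟩, h, rfl⟩
      exact ⟨x, (Submodule.Quotient.mk_eq_zero J).1 h, rfl⟩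
    · rintro ⟨x, hx, rfl⟩
      exact ⟨⟨_, x, hJA hx, rfl⟩, (Submodule.Quotient.mk_eq_zero J).2 hx, rfl⟩
  have h := f.rank_range_add_rank_ker
  rw [hr] at h
  unfold relRank
  rw [← h, ← hk, rank_map_eq (Submodule.injective_subtype _)]

/-- Rank-nullity for the map V/W → V'/f(W) induced by f, whose kernel is the image of ker f. -/
lemma relRank_range_add_relRank_ker
    (f : V →ₗ[K] V') (W : Submodule K V) :
    lift.{u} (relRank (LinearMap.range f) (W.map f)) + lift.{v} (relRank (LinearMap.ker f) W) =
      lift.{v} (Module.rank K (V ⧸ W)) := by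
  let g : V ⧸ W →ₗ[K] V' ⧸ W.map f := Submodule.mapQ W (W.map f) f (Submodule.le_comap_map f W)
  have hr : LinearMap.range g = (LinearMap.range f).map (W.map f).mkQ := by
    rw [Submodule.range_mapQ]
  have hk : LinearMap.ker g = (LinearMap.ker f).map W.mkQ := by
    ext y
    obtain ⟨x, rfl⟩ := W.mkQ_surjective y
    constructor
    · intro h
      obtain ⟨w, hw, hwx⟩ := (Submodule.Quotient.mk_eq_zero (W.map f)).1 h
      refine ⟨x - w, by simp [hwx], ?_⟩
      rw [map_sub, sub_eq_self]
      simpa using hw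
    · rintro ⟨z, hz, hzx⟩
      rw [← hzx]
      simp [g, LinearMap.mem_ker.1 hz]
  have h := g.lift_rank_range_add_rank_ker
  rwa [hr, hk] at h

/-- Two subspaces are commensurable if their intersection has finite codimension in both. -/
structure IsCommensurable (A B : Submodule K V) : Prop where
  left : relRank A B < ℵ₀
  right : relRank B A < ℵ₀

/-- The relative dimension `dim A / (A ∩ B) - dim B / (A ∩ B)`. -/
noncomputable def relDim (A B : Submodule K V) : ℤ :=
  (toNat (relRank A B) : ℤ) - toNat (relRank B A)

lemma IsCommensurable.symm {A B : Submodule K V} (h : IsCommensurable A B) :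
    IsCommensurable B A := ⟨h.2, h.1⟩

lemma relDim_symm (A B : Submodule K V) : relDim B A = -relDim A B := by
  simp [relDim]

lemma relRank_of_le {A B I : Submodule K V} (hA : I ≤ A) (hB : I ≤ B) :
    relRank A I = relRank A B + relRank (A ⊓ B) I := by
  rw [relRank_add_relRank (le_inf hA hB) inf_le_left, relRank_inf_left]

lemma isCommensurable_of_le {A B I : Submodule K V} (hA : I ≤ A) (hB : I ≤ B)
    (fA : relRank A I < ℵ₀) (fB : relRank B I < ℵ₀) : IsCommensurable A B := by
  constructor
  · exact lt_of_le_of_lt (by rw [relRank_of_le hA hB]; exact self_le_add_right _ _) fA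
  · exact lt_of_le_of_lt (by rw [relRank_of_le hB hA]; exact self_le_add_right _ _) fB

/-- The common term dim (A ∩ B)/I cancels. Measuring against one small `I` makes additivity
immediate. -/
lemma relDim_eq_of_le {A B I : Submodule K V} (hA : I ≤ A) (hB : I ≤ B)
    (fA : relRank A I < ℵ₀) (fB : relRank B I < ℵ₀) :
    relDim A B = (toNat (relRank A I) : ℤ) - toNat (relRank B I) := by
  have h := isCommensurable_of_le hA hB fA fB
  have e1 := relRank_of_le hA hB
  have e2 := relRank_of_le hB hA
  have f1 : relRank (A ⊓ B) I < ℵ₀ := (relRank_mono_left inf_le_left I).trans_lt fA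
  rw [inf_comm] at e2
  rw [e1, e2, toNat_add h.1 f1, toNat_add h.2 f1, relDim]
  push_cast
  ring

lemma IsCommensurable.exists_le {A B C : Submodule K V} (hAB : IsCommensurable A B)
    (hBC : IsCommensurable B C) : ∃ I : Submodule K V, I ≤ A ∧ I ≤ B ∧ I ≤ C ∧
      relRank A I < ℵ₀ ∧ relRank B I < ℵ₀ ∧ relRank C I < ℵ₀ := by
  have h1 : relRank (A ⊓ B) (A ⊓ B ⊓ C) < ℵ₀ := by
    rw [relRank_inf_left]
    exact (relRank_mono_left inf_le_right C).trans_lt hBC.1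
  have h2 : relRank (B ⊓ C) (A ⊓ B ⊓ C) < ℵ₀ := by
    rw [inf_assoc, inf_comm A, relRank_inf_left]
    exact (relRank_mono_left inf_le_left A).trans_lt hAB.2
  refine ⟨A ⊓ B ⊓ C, inf_le_left.trans inf_le_left, inf_le_left.trans inf_le_right, inf_le_right,
    ?_, ?_, ?_⟩
  · rw [relRank_add_relRank inf_le_left (inf_le_left : A ⊓ B ≤ A), relRank_inf_left]
    exact add_lt_aleph0 hAB.1 h1
  · rw [relRank_add_relRank inf_le_left (inf_le_right : A ⊓ B ≤ B), inf_comm A B, relRank_inf_left,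
      inf_comm B A]
    exact add_lt_aleph0 hAB.2 h1
  · rw [relRank_add_relRank (le_inf (inf_le_left.trans inf_le_right) inf_le_right)
      (inf_le_right : B ⊓ C ≤ C), inf_comm B C, relRank_inf_left, inf_comm C B]
    exact add_lt_aleph0 hBC.2 h2

lemma IsCommensurable.trans {A B C : Submodule K V} (hAB : IsCommensurable A B)
    (hBC : IsCommensurable B C) : IsCommensurable A C := by
  obtain ⟨I, hA, hB, hC, fA, fB, fC⟩ := hAB.exists_le hBC
  exact isCommensurable_of_le hA hC fA fC

lemma IsCommensurable.relDim_add {A B C : Submodule K V} (hAB : IsCommensurable A B)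
    (hBC : IsCommensurable B C) : relDim A B + relDim B C = relDim A C := by
  obtain ⟨I, hA, hB, hC, fA, fB, fC⟩ := hAB.exists_le hBC
  rw [relDim_eq_of_le hA hB fA fB, relDim_eq_of_le hB hC fB fC, relDim_eq_of_le hA hC fA fC]
  ring

lemma relRank_ker_range_lt_aleph0 (f : V →ₗ[K] V') {W : Submodule K V}
    (hW : Module.rank K (V ⧸ W) < ℵ₀) :
    relRank (LinearMap.range f) (W.map f) < ℵ₀ ∧ relRank (LinearMap.ker f) W < ℵ₀ ∧
      toNat (relRank (LinearMap.range f) (W.map f)) + toNat (relRank (LinearMap.ker f) W) =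
        toNat (Module.rank K (V ⧸ W)) := by
  have h := relRank_range_add_relRank_ker f W
  have hW' := lift_lt_aleph0.2 hW
  rw [← h] at hW'
  obtain ⟨h1, h2⟩ := add_lt_aleph0_iff.1 hW'
  refine ⟨lift_lt_aleph0.1 h1, lift_lt_aleph0.1 h2, ?_⟩
  have := congrArg toNat h
  rw [toNat_add h1 h2] at this
  simpa using this

/-- Under a finite rank perturbation the kernels and the ranges stay commensurable, with opposite
relative dimensions. -/
lemma isCommensurable_of_finite_range_sub (f g : V →ₗ[K] V')
    (h : FiniteDimensional K (LinearMap.range (f - g))) :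
    IsCommensurable (LinearMap.ker f) (LinearMap.ker g) ∧
      IsCommensurable (LinearMap.range f) (LinearMap.range g) ∧
      relDim (LinearMap.ker f) (LinearMap.ker g) +
        relDim (LinearMap.range f) (LinearMap.range g) = 0 := by
  -- On `W` the two maps agree, so they share f(W) and ker f ∩ W; `W` has finite codimension because
  -- V/W ≅ R(f - g). Both defect sums then equal dim V/W.
  set W := LinearMap.ker (f - g) with hWdef
  have hmem : ∀ x, x ∈ W ↔ f x = g x := fun x => by simp [W, sub_eq_zero]
  have hW : Module.rank K (V ⧸ W) < ℵ₀ := by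
    have e : (V ⧸ W) ≃ₗ[K] LinearMap.range (f - g) := (f - g).quotKerEquivRange
    have : FiniteDimensional K (V ⧸ W) := e.symm.finiteDimensional
    exact Module.rank_lt_aleph0 K _
  have hmap : W.map f = W.map g := by
    ext y
    constructor
    · rintro ⟨x, hx, rfl⟩
      exact ⟨x, hx, ((hmem x).1 hx).symm⟩
    · rintro ⟨x, hx, rfl⟩
      exact ⟨x, hx, (hmem x).1 hx⟩
  have hker : LinearMap.ker f ⊓ W = LinearMap.ker g ⊓ W := by
    ext x
    simp only [Submodule.mem_inf, LinearMap.mem_ker, hmem]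
    constructor <;> rintro ⟨h1, h2⟩
    · exact ⟨h2 ▸ h1, h2⟩
    · exact ⟨h2.trans h1, h2⟩
  obtain ⟨f1, f2, f3⟩ := relRank_ker_range_lt_aleph0 f hW
  obtain ⟨g1, g2, g3⟩ := relRank_ker_range_lt_aleph0 g hW
  rw [← relRank_inf_left (LinearMap.ker _) W] at f2 f3 g2 g3
  rw [← hker] at g2 g3
  rw [← hmap] at g1 g3
  have l1 : LinearMap.ker f ⊓ W ≤ LinearMap.ker g := hker ▸ inf_le_left
  have l2 : W.map f ≤ LinearMap.range g := hmap ▸ LinearMap.map_le_range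
  refine ⟨isCommensurable_of_le inf_le_left l1 f2 g2,
    isCommensurable_of_le LinearMap.map_le_range l2 f1 g1, ?_⟩
  rw [relDim_eq_of_le inf_le_left l1 f2 g2, relDim_eq_of_le LinearMap.map_le_range l2 f1 g1]
  omega

end RelRank

end Submodule

/-! ### Fredholm operators between Hilbert spaces -/

namespace HilbertChain

open Submodule Cardinal

section FiniteRank

variable {K V V' V'' : Type*} [DivisionRing K] [AddCommGroup V] [Module K V]
  [AddCommGroup V'] [Module K V'] [AddCommGroup V''] [Module K V'']

lemma finiteRange_add {f g : V →ₗ[K] V'} (hf : FiniteDimensional K (LinearMap.range f))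
    (hg : FiniteDimensional K (LinearMap.range g)) :
    FiniteDimensional K (LinearMap.range (f + g)) :=
  Submodule.finiteDimensional_of_le (LinearMap.range_add_le f g)

lemma finiteRange_comp_right {f : V' →ₗ[K] V''} (hf : FiniteDimensional K (LinearMap.range f))
    (g : V →ₗ[K] V') : FiniteDimensional K (LinearMap.range (f ∘ₗ g)) :=
  Submodule.finiteDimensional_of_le (LinearMap.range_comp_le_range g f)

lemma relRank_bot (A : Submodule K V) : relRank A ⊥ = Module.rank K A :=
  rank_map_eq (LinearMap.ker_eq_bot.1 (Submodule.ker_mkQ _)) A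

lemma relRank_bot_left (A : Submodule K V) : relRank ⊥ A = 0 := by
  simp [relRank]

lemma relRank_top_left (A : Submodule K V) : relRank ⊤ A = Module.rank K (V ⧸ A) := by
  rw [relRank, Submodule.map_top, Submodule.range_mkQ, rank_top]

end FiniteRank

section Hilbert

variable {𝕜 E F : Type*} [RCLike 𝕜] [NormedAddCommGroup E] [InnerProductSpace 𝕜 E]
  [NormedAddCommGroup F] [InnerProductSpace 𝕜 F]

lemma apply_starProjection_orthogonal_ker [CompleteSpace E] (T : E →L[𝕜] F) (x : E) :
    T (x - T.ker.starProjection x) = T x := by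
  rw [map_sub, sub_eq_self]
  exact T.ker.starProjection_apply_mem x

lemma ker_domRestrict_orthogonal_ker (T : E →L[𝕜] F) (x : T.kerᗮ) (hx : T x = 0) : x = 0 := by
  have h1 : (x : E) ∈ T.ker := hx
  have h2 : (x : E) ∈ T.ker ⊓ T.kerᗮ := ⟨h1, x.2⟩
  rw [Submodule.inf_orthogonal_eq_bot] at h2
  exact Subtype.ext h2

/-- Compact operators into a Hilbert space are norm limits of finite rank operators. -/
lemma exists_finiteRange_norm_sub_lt {T : E →L[𝕜] F} (hT : IsCompactOperator T) {ε : ℝ}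
    (hε : 0 < ε) : ∃ S : E →L[𝕜] F, FiniteDimensional 𝕜 S.range ∧ ‖T - S‖ < ε := by
  obtain ⟨C, hC, hsub⟩ :=
    IsCompactOperator.image_closedBall_subset_compact (f := (T : E →ₗ[𝕜] F)) hT 1
  obtain ⟨t, ht, htC⟩ := Metric.totallyBounded_iff.1 hC.totallyBounded (ε / 2) (by positivity)
  -- Projecting onto the span of a finite ε/2-net of a compact set containing the image of the unit
  -- ball moves that image by at most ε/2.
  let W := span 𝕜 t
  have : FiniteDimensional 𝕜 W := FiniteDimensional.span_of_finite 𝕜 ht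
  refine ⟨W.starProjection ∘L T, ?_, ?_⟩
  · refine Submodule.finiteDimensional_of_le (S₂ := W) ?_
    rintro _ ⟨x, rfl⟩
    exact W.starProjection_apply_mem _
  · refine lt_of_le_of_lt ?_ (half_lt_self hε)
    refine ContinuousLinearMap.opNorm_le_of_unit_norm (by positivity) fun x hx => ?_
    have hTx : T x ∈ C := hsub ⟨x, by simp [hx], rfl⟩
    obtain ⟨y, hy, hxy⟩ := Set.mem_iUnion₂.1 (htC hTx)
    have hmin := W.starProjection_minimal (T x)
    have hb : BddBelow (Set.range fun w : W => ‖T x - w‖) :=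
      ⟨0, by rintro _ ⟨w, rfl⟩; exact norm_nonneg _⟩
    calc ‖(T - W.starProjection ∘L T) x‖ = ‖T x - W.starProjection (T x)‖ := by simp
      _ ≤ ‖T x - y‖ := by
        rw [hmin]
        exact ciInf_le hb ⟨y, subset_span hy⟩
      _ ≤ ε / 2 := by
        rw [← dist_eq_norm]
        exact hxy.le

variable [CompleteSpace E] [CompleteSpace F]

/-- A bounded operator with closed range has a bounded pseudo-inverse. -/
lemma exists_pseudoInverse (T : E →L[𝕜] F) (h : IsClosed (T.range : Set F)) :
    ∃ G : F →L[𝕜] E, ∀ x, T (G (T x)) = T x := by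
  have : CompleteSpace T.range := h.completeSpace_coe
  -- A continuous bijection of Hilbert spaces; its inverse is bounded by the open mapping theorem.
  let f : T.kerᗮ →L[𝕜] T.range :=
    (T ∘L T.kerᗮ.subtypeL).codRestrict T.range (fun x => LinearMap.mem_range_self _ _)
  have hinj : f.ker = ⊥ := by
    rw [LinearMap.ker_eq_bot']
    intro x hx
    exact ker_domRestrict_orthogonal_ker T x (congrArg Subtype.val hx)
  have hsurj : f.range = ⊤ := by
    rw [LinearMap.range_eq_top]
    rintro ⟨_, x, rfl⟩
    exact ⟨⟨_, T.ker.sub_starProjection_mem_orthogonal x⟩,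
      Subtype.ext (apply_starProjection_orthogonal_ker T x)⟩
  let e := ContinuousLinearEquiv.ofBijective f hinj hsurj
  refine ⟨T.kerᗮ.subtypeL ∘L (e.symm : T.range →L[𝕜] T.kerᗮ) ∘L T.range.orthogonalProjectionOnto,
    fun x => ?_⟩
  have hx : T.range.orthogonalProjectionOnto (T x) = ⟨T x, LinearMap.mem_range_self _ _⟩ :=
    T.range.orthogonalProjectionOnto_mem_subspace_eq_self ⟨T x, LinearMap.mem_range_self _ _⟩
  have := congrArg Subtype.val (e.apply_symm_apply ⟨T x, LinearMap.mem_range_self _ _⟩)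
  change T (e.symm (T.range.orthogonalProjectionOnto (T x))) = T x
  rw [hx]
  exact this

/-- A range of finite codimension in a closed subspace is closed. -/
lemma isClosed_range_of_relRank_lt (T : E →L[𝕜] F) {S : Submodule 𝕜 F}
    (hS : IsClosed (S : Set F)) (hle : T.range ≤ S) (hfin : relRank S T.range < ℵ₀) :
    IsClosed (T.range : Set F) := by
  have : CompleteSpace S := hS.completeSpace_coe
  let f : T.kerᗮ →L[𝕜] S :=
    (T ∘L T.kerᗮ.subtypeL).codRestrict S (fun x => hle (LinearMap.mem_range_self _ _))
  have hinj : f.ker = ⊥ := by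
    rw [LinearMap.ker_eq_bot']
    intro x hx
    exact ker_domRestrict_orthogonal_ker T x (congrArg Subtype.val hx)
  have hmem : ∀ y : S, y ∈ f.range ↔ (y : F) ∈ T.range := by
    intro y
    constructor
    · rintro ⟨x, rfl⟩
      exact ⟨x, rfl⟩
    · rintro ⟨x, hx⟩
      exact ⟨⟨_, T.ker.sub_starProjection_mem_orthogonal x⟩,
        Subtype.ext ((apply_starProjection_orthogonal_ker T x).trans hx)⟩
  have hrank := relRank_eq_of_surjective (A := S) (B := T.range) f.range.mkQ
    (Submodule.mkQ_surjective _)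
    (fun x => by rw [Submodule.mkQ_apply, Submodule.Quotient.mk_eq_zero, hmem])
  have hq : FiniteDimensional 𝕜 (S ⧸ f.range) := by
    rw [FiniteDimensional, ← Module.rank_lt_aleph0_iff, ← lift_lt_aleph0, ← hrank, lift_lt_aleph0]
    exact hfin
  -- An algebraic complement suffices: being finite dimensional, it is closed.
  obtain ⟨C, hC⟩ := Submodule.exists_isCompl f.range
  have : FiniteDimensional 𝕜 C := (Submodule.quotientEquivOfIsCompl _ _ hC).finiteDimensional
  have hcl : IsClosed (f.range : Set S) :=
    f.closed_complemented_range_of_isCompl_of_ker_eq_bot C hC C.closed_of_finiteDimensional hinj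
  have himg : (T.range : Set F) = Subtype.val '' (f.range : Set S) := by
    ext y
    constructor
    · intro hy
      exact ⟨⟨y, hle hy⟩, (hmem _).2 hy, rfl⟩
    · rintro ⟨y, hy, rfl⟩
      exact (hmem y).1 hy
  rw [himg]
  exact hS.isClosedMap_subtype_val _ hcl

/-- S* vanishes on R(S)ᗮ, so its range is the image of R(S). -/
lemma finiteRange_adjoint (S : E →L[𝕜] F) (h : FiniteDimensional 𝕜 S.range) :
    FiniteDimensional 𝕜 (ContinuousLinearMap.adjoint S).range := by
  let A := ContinuousLinearMap.adjoint S
  refine Submodule.finiteDimensional_of_le (S₂ := S.range.map (A : F →ₗ[𝕜] E)) ?_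
  rintro _ ⟨x, rfl⟩
  refine ⟨S.range.starProjection x, S.range.starProjection_apply_mem x, ?_⟩
  have h1 : x - S.range.starProjection x ∈ A.ker := by
    rw [← ContinuousLinearMap.orthogonal_range]
    exact S.range.sub_starProjection_mem_orthogonal x
  have h2 : A x - A (S.range.starProjection x) = 0 := by rw [← map_sub]; exact h1
  exact (sub_eq_zero.1 h2).symm

/-- Finite dimensionality of kernel and cokernel, and the index, are stable under perturbations
which are norm limits of finite rank operators. -/
lemma fredholm_add_of_approximable (D T : E →L[𝕜] F)
    (hker : IsCommensurable D.ker ⊥) (hran : IsCommensurable D.range ⊤)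
    (hT : ∀ ε > 0, ∃ S : E →L[𝕜] F, FiniteDimensional 𝕜 S.range ∧ ‖T - S‖ < ε) :
    IsCommensurable (D + T).ker ⊥ ∧ IsCommensurable (D + T).range ⊤ ∧
      relDim (D + T).ker ⊥ + relDim (D + T).range ⊤ = relDim D.ker ⊥ + relDim D.range ⊤ := by
  have hcl : IsClosed (D.range : Set F) :=
    isClosed_range_of_relRank_lt D (S := ⊤) isClosed_univ le_top hran.2
  obtain ⟨G, hG⟩ := exists_pseudoInverse D hcl
  -- This bound forces ‖GX‖ < 1 for X = T - S, so that U = 1 + GX is invertible.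
  obtain ⟨S, hS, hTS⟩ := hT (‖G‖ + 1)⁻¹ (by positivity)
  let X := T - S
  have hnorm : ‖-(G ∘L X)‖ < 1 := by
    rw [norm_neg]
    calc ‖G ∘L X‖ ≤ ‖G‖ * ‖X‖ := ContinuousLinearMap.opNorm_comp_le _ _
      _ ≤ ‖G‖ * (‖G‖ + 1)⁻¹ := by gcongr
      _ < 1 := by
        rw [← div_eq_mul_inv, div_lt_one (by positivity)]
        linarith
  obtain ⟨u, hu⟩ := isUnit_one_sub_of_norm_lt_one (x := -(G ∘L X)) hnorm
  let U : E ≃L[𝕜] E := ContinuousLinearEquiv.ofUnit u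
  have hU : ∀ x, U x = x + G (X x) := fun x => by
    change (u : E →L[𝕜] E) x = _
    rw [hu]
    simp
  -- M = D + DGX has the index of D, and D + T - M = (1 - DG)X + S has finite rank: 1 - DG kills
  -- R(D), which has finite codimension.
  let M : E →L[𝕜] F := D ∘L (U : E →L[𝕜] E)
  have hMr : M.range = D.range := by
    ext y
    constructor
    · rintro ⟨x, rfl⟩
      exact ⟨U x, rfl⟩
    · rintro ⟨x, rfl⟩
      exact ⟨U.symm x, by simp [M]⟩
  have hMk : relRank M.ker ⊥ = relRank D.ker ⊥ := by
    rw [relRank_bot, relRank_bot]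
    have : M.ker.map (U.toLinearEquiv : E →ₗ[𝕜] E) = D.ker := by
      ext y
      constructor
      · rintro ⟨x, hx, rfl⟩
        exact hx
      · intro hy
        exact ⟨U.symm y, by simpa [M] using hy, by simp⟩
    rw [← this]
    exact (LinearEquiv.rank_map_eq U.toLinearEquiv M.ker).symm
  have hMc : IsCommensurable M.ker ⊥ := ⟨hMk ▸ hker.1, by rw [relRank_bot_left]; exact aleph0_pos⟩
  have hMd : relDim M.ker ⊥ = relDim D.ker ⊥ := by
    rw [relDim, relDim, hMk, relRank_bot_left, relRank_bot_left]
  have hdiff : FiniteDimensional 𝕜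
      (LinearMap.range (((D + T : E →L[𝕜] F) : E →ₗ[𝕜] F) - (M : E →ₗ[𝕜] F))) := by
    let Q : F →ₗ[𝕜] F := LinearMap.id - ((D ∘L G : F →L[𝕜] F) : F →ₗ[𝕜] F)
    have hQ : FiniteDimensional 𝕜 (LinearMap.range Q) := by
      have hle : D.range ≤ LinearMap.ker Q := by
        rintro _ ⟨x, rfl⟩
        simp [Q, hG]
      have hrQ : LinearMap.range Q = LinearMap.range (D.range.liftQ Q hle) := by
        rw [Submodule.range_liftQ]
      have : FiniteDimensional 𝕜 (F ⧸ D.range) := by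
        rw [FiniteDimensional, ← Module.rank_lt_aleph0_iff, ← relRank_top_left]
        exact hran.2
      rw [hrQ]
      infer_instance
    have hE : ((D + T : E →L[𝕜] F) : E →ₗ[𝕜] F) - (M : E →ₗ[𝕜] F)
        = Q ∘ₗ (X : E →ₗ[𝕜] F) + (S : E →ₗ[𝕜] F) := by
      ext x
      simp [M, hU, Q, X]
      abel
    rw [hE]
    exact finiteRange_add (finiteRange_comp_right hQ _) hS
  obtain ⟨c1, c2, c3⟩ := isCommensurable_of_finite_range_sub _ _ hdiff
  rw [hMr] at c2 c3
  refine ⟨c1.trans hMc, c2.trans hran, ?_⟩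
  rw [← c1.relDim_add hMc, ← c2.relDim_add hran, hMd]
  linarith

end Hilbert

end HilbertChain

/-! ### Pairs of operators `E ⇄ O` which are a complex up to finite rank -/

namespace HilbertChain

open Submodule Cardinal

section PairAlgebra

variable {K V V' V'' : Type*} [DivisionRing K] [AddCommGroup V] [Module K V]
  [AddCommGroup V'] [Module K V'] [AddCommGroup V''] [Module K V'']

lemma relRank_eq_zero_of_le {A B : Submodule K V} (h : A ≤ B) : relRank A B = 0 := by
  have : A.map B.mkQ = ⊥ := by
    rw [eq_bot_iff]
    rintro _ ⟨x, hx, rfl⟩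
    simpa using h hx
  rw [relRank, this, rank_bot]

lemma relRank_eq_of_inf_eq {A B C : Submodule K V} (h : A ⊓ B = A ⊓ C) :
    relRank A B = relRank A C := by
  rw [← relRank_inf_left, h, relRank_inf_left]

lemma finiteRange_comp_iff (f : V →ₗ[K] V') (g : V' →ₗ[K] V'') :
    FiniteDimensional K (LinearMap.range (g ∘ₗ f)) ↔
      relRank (LinearMap.range f) (LinearMap.ker g) < ℵ₀ := by
  have h := relRank_eq_of_surjective (A := LinearMap.range f) (B := LinearMap.ker g)
    (g.submoduleMap (LinearMap.range f)) (g.submoduleMap_surjective _)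
    (fun x => by rw [← Subtype.coe_inj]; rfl)
  rw [LinearMap.range_comp, FiniteDimensional, ← Module.rank_lt_aleph0_iff, ← lift_lt_aleph0, ← h,
    lift_lt_aleph0]

lemma finiteRange_sub_comm {f g : V →ₗ[K] V'}
    (h : FiniteDimensional K (LinearMap.range (f - g))) :
    FiniteDimensional K (LinearMap.range (g - f)) := by
  rw [← neg_sub, LinearMap.range_neg]
  exact h

/-- The kernel-range pairs of `a : V → V'` and `b : V' → V` are commensurable. -/
structure IsFredholmPair (a : V →ₗ[K] V') (b : V' →ₗ[K] V) : Prop where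
  left : IsCommensurable (LinearMap.ker a) (LinearMap.range b)
  right : IsCommensurable (LinearMap.ker b) (LinearMap.range a)

/-- The Euler characteristic of the pair `a : V → V'`, `b : V' → V`. -/
noncomputable def pairIndex (a : V →ₗ[K] V') (b : V' →ₗ[K] V) : ℤ :=
  relDim (LinearMap.ker a) (LinearMap.range b) - relDim (LinearMap.ker b) (LinearMap.range a)

lemma IsFredholmPair.symm {a : V →ₗ[K] V'} {b : V' →ₗ[K] V} (h : IsFredholmPair a b) :
    IsFredholmPair b a := ⟨h.2, h.1⟩

lemma IsFredholmPair.of_finiteRange_sub {a a' : V →ₗ[K] V'} {b b' : V' →ₗ[K] V}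
    (h : IsFredholmPair a b) (ha : FiniteDimensional K (LinearMap.range (a' - a)))
    (hb : FiniteDimensional K (LinearMap.range (b' - b))) :
    IsFredholmPair a' b' ∧ pairIndex a' b' = pairIndex a b := by
  obtain ⟨a1, a2, a3⟩ := isCommensurable_of_finite_range_sub _ _ ha
  obtain ⟨b1, b2, b3⟩ := isCommensurable_of_finite_range_sub _ _ hb
  refine ⟨⟨(a1.trans h.1).trans b2.symm, (b1.trans h.2).trans a2.symm⟩, ?_⟩
  rw [pairIndex, pairIndex, ← (a1.trans h.1).relDim_add b2.symm, ← a1.relDim_add h.1,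
    ← (b1.trans h.2).relDim_add a2.symm, ← b1.relDim_add h.2, relDim_symm (LinearMap.range a'),
    relDim_symm (LinearMap.range b')]
  linarith

end PairAlgebra

section Pair

variable {𝕜 E F : Type*} [RCLike 𝕜] [NormedAddCommGroup E] [InnerProductSpace 𝕜 E]
  [NormedAddCommGroup F] [InnerProductSpace 𝕜 F]

/-- c' - c is compact up to finite rank. Approximability is recorded instead of compactness because
it passes directly to adjoints. -/
lemma approximable_sub_of_compact {a a' c c' : E →L[𝕜] F} (ha : IsCompactOperator (a' - a))
    (hac : FiniteDimensional 𝕜 (a - c).range) (hac' : FiniteDimensional 𝕜 (a' - c').range) :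
    ∀ ε > 0, ∃ S : E →L[𝕜] F, FiniteDimensional 𝕜 S.range ∧ ‖(c' - c) - S‖ < ε := by
  intro ε hε
  obtain ⟨S, hS, hS'⟩ := exists_finiteRange_norm_sub_lt (T := a' - a) ha hε
  refine ⟨S + ((a - c) + -(a' - c')), ?_, ?_⟩
  · refine finiteRange_add hS (finiteRange_add hac ?_)
    rw [ContinuousLinearMap.toLinearMap_neg, LinearMap.range_neg]
    exact hac'
  · have e : (c' - c) - (S + ((a - c) + -(a' - c'))) = (a' - a) - S := by abel
    rwa [e]

lemma finiteRange_comp_starProjection_ker_sub [CompleteSpace E] {G : Type*} [NormedAddCommGroup G]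
    [InnerProductSpace 𝕜 G] (T : E →L[𝕜] G) (h : FiniteDimensional 𝕜 T.range) (b : E →L[𝕜] F) :
    FiniteDimensional 𝕜 (b - b ∘L T.ker.starProjection).range := by
  have hfin : FiniteDimensional 𝕜 T.kerᗮ := by
    let f : T.kerᗮ →ₗ[𝕜] T.range :=
      ((T : E →ₗ[𝕜] G) ∘ₗ T.kerᗮ.subtype).codRestrict _ (fun x => LinearMap.mem_range_self _ _)
    refine Module.Finite.of_injective f ((injective_iff_map_eq_zero f).2 fun x hx => ?_)
    exact ker_domRestrict_orthogonal_ker T x (congrArg Subtype.val hx)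
  refine Submodule.finiteDimensional_of_le (S₂ := T.kerᗮ.map (b : E →ₗ[𝕜] F)) ?_
  rintro _ ⟨x, rfl⟩
  exact ⟨x - T.ker.starProjection x, T.ker.sub_starProjection_mem_orthogonal x, by simp⟩

variable [CompleteSpace E] [CompleteSpace F]

open ContinuousLinearMap (adjoint)

lemma adjoint_apply_mem_orthogonal_ker (b : F →L[𝕜] E) (x : E) : adjoint b x ∈ b.kerᗮ := by
  rw [ContinuousLinearMap.orthogonal_ker]
  exact Submodule.le_topologicalClosure _ (LinearMap.mem_range_self _ x)

/-- From bGb = b, every Gbw - w lies in ker b; hence b*G*y = y for y ⟂ ker b. -/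
lemma orthogonal_ker_le_range_adjoint (b : F →L[𝕜] E) (h : IsClosed (b.range : Set E)) :
    b.kerᗮ ≤ (adjoint b).range := by
  obtain ⟨G, hG⟩ := exists_pseudoInverse b h
  intro y hy
  refine ⟨adjoint G y, ?_⟩
  refine ext_inner_right 𝕜 fun w => ?_
  change inner 𝕜 (adjoint b (adjoint G y)) w = _
  rw [ContinuousLinearMap.adjoint_inner_left, ContinuousLinearMap.adjoint_inner_left]
  have hw : G (b w) - w ∈ b.ker := by
    simp [hG]
  have := Submodule.inner_left_of_mem_orthogonal hw hy
  rw [inner_sub_right, sub_eq_zero] at this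
  exact this

/-! ### Hodge theory of a two-term cyclic complex -/

section Complex

variable {a : E →L[𝕜] F} {b : F →L[𝕜] E}

/-- Since ax is in ker b, b*x lies in both ker b and its orthogonal complement. -/
lemma adjoint_apply_eq_zero_of_add_mem_ker (hba : ∀ x, b (a x) = 0) {x : E}
    (hx : a x + adjoint b x ∈ b.ker) : adjoint b x = 0 := by
  have h1 : adjoint b x ∈ b.ker := by
    have : a x ∈ b.ker := hba x
    simpa using sub_mem hx this
  have h2 : adjoint b x ∈ b.ker ⊓ b.kerᗮ := ⟨h1, adjoint_apply_mem_orthogonal_ker b x⟩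
  rw [Submodule.inf_orthogonal_eq_bot] at h2
  exact h2

lemma mem_ker_add_adjoint_iff (hba : ∀ x, b (a x) = 0) (x : E) :
    x ∈ (a + adjoint b).ker ↔ a x = 0 ∧ adjoint b x = 0 := by
  constructor
  · intro hx
    have hx' : a x + adjoint b x = 0 := hx
    have h := adjoint_apply_eq_zero_of_add_mem_ker hba (x := x) (by rw [hx']; exact zero_mem _)
    exact ⟨by simpa [h] using hx', h⟩
  · rintro ⟨h1, h2⟩
    simp [h1, h2]

lemma adjoint_apply_eq_zero_of_mem_orthogonal_ker (hab : ∀ y, a (b y) = 0) {x : E}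
    (hx : x ∈ a.kerᗮ) : adjoint b x = 0 := by
  have hle : b.range ≤ a.ker := by
    rintro _ ⟨y, rfl⟩
    exact hab y
  have : x ∈ b.rangeᗮ := Submodule.orthogonal_le hle hx
  rw [ContinuousLinearMap.orthogonal_range] at this
  exact this

/-- Moving x into (ker a)ᗮ keeps ax and makes b*x vanish. -/
lemma range_le_range_add_adjoint (hab : ∀ y, a (b y) = 0) :
    a.range ≤ (a + adjoint b).range := by
  rintro _ ⟨x, rfl⟩
  refine ⟨x - a.ker.starProjection x, ?_⟩
  have := adjoint_apply_eq_zero_of_mem_orthogonal_ker hab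
    (a.ker.sub_starProjection_mem_orthogonal x)
  change a _ + adjoint b _ = a x
  rw [this, add_zero, apply_starProjection_orthogonal_ker]

lemma range_adjoint_le_range_add_adjoint (hab : ∀ y, a (b y) = 0) :
    (adjoint b).range ≤ (a + adjoint b).range := by
  rintro _ ⟨x, rfl⟩
  refine ⟨a.ker.starProjection x, ?_⟩
  have := adjoint_apply_eq_zero_of_mem_orthogonal_ker hab
    (a.ker.sub_starProjection_mem_orthogonal x)
  rw [map_sub, sub_eq_zero] at this
  have h2 : a (a.ker.starProjection x) = 0 := a.ker.starProjection_apply_mem x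
  change a _ + adjoint b _ = adjoint b x
  rw [h2, zero_add, this]

lemma relRank_ker_range_add_adjoint (hab : ∀ y, a (b y) = 0) (hba : ∀ x, b (a x) = 0) :
    relRank b.ker (a + adjoint b).range = relRank b.ker a.range := by
  refine relRank_eq_of_inf_eq (le_antisymm ?_ (inf_le_inf_left _ (range_le_range_add_adjoint hab)))
  rintro _ ⟨hy, x, rfl⟩
  refine ⟨hy, x, ?_⟩
  have := adjoint_apply_eq_zero_of_add_mem_ker hba (x := x) hy
  change a x = a x + adjoint b x
  rw [this, add_zero]

/-- For a complex `E ⇄ F` with finite dimensional cohomology, `a + b*` is Fredholm and its index is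
the Euler characteristic. -/
lemma fredholm_add_adjoint (hab : ∀ y, a (b y) = 0) (hba : ∀ x, b (a x) = 0)
    (h : IsFredholmPair (a : E →ₗ[𝕜] F) (b : F →ₗ[𝕜] E)) :
    IsCommensurable (a + adjoint b).ker ⊥ ∧ IsCommensurable (a + adjoint b).range ⊤ ∧
      relDim (a + adjoint b).ker ⊥ + relDim (a + adjoint b).range ⊤ =
        pairIndex (a : E →ₗ[𝕜] F) (b : F →ₗ[𝕜] E) := by
  have hb_le : b.range ≤ a.ker := by
    rintro _ ⟨y, rfl⟩
    exact hab y
  have ha_le : a.range ≤ b.ker := by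
    rintro _ ⟨y, rfl⟩
    exact hba y
  have hb_cl : IsClosed (b.range : Set E) :=
    isClosed_range_of_relRank_lt b a.isClosed_ker hb_le h.1.1
  have : CompleteSpace b.range := hb_cl.completeSpace_coe
  -- Harmonic representatives: subtracting the projection to R(b) maps ker a onto ker (a + b*) with
  -- kernel R(b).
  have hk : relRank (a + adjoint b).ker ⊥ = relRank a.ker b.range := by
    have hmem : ∀ x : a.ker, (x : E) - b.range.starProjection x ∈ (a + adjoint b).ker := by
      intro x
      rw [mem_ker_add_adjoint_iff hba]
      constructor
      · have h1 : b.range.starProjection (x : E) ∈ a.ker :=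
          hb_le (b.range.starProjection_apply_mem _)
        exact sub_mem x.2 h1
      · have h1 := b.range.sub_starProjection_mem_orthogonal (x : E)
        rw [ContinuousLinearMap.orthogonal_range] at h1
        exact h1
    let f : a.ker →ₗ[𝕜] (a + adjoint b).ker :=
      LinearMap.codRestrict _
        ((LinearMap.id - (b.range.starProjection : E →ₗ[𝕜] E)) ∘ₗ a.ker.subtype) hmem
    have hf : Function.Surjective f := by
      rintro ⟨x, hx⟩
      obtain ⟨h1, h2⟩ := (mem_ker_add_adjoint_iff hba x).1 hx
      refine ⟨⟨x, h1⟩, Subtype.ext ?_⟩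
      have h3 : x ∈ b.rangeᗮ := by
        rw [ContinuousLinearMap.orthogonal_range]
        exact h2
      have h4 : b.range.starProjection x = 0 :=
        (Submodule.starProjection_apply_eq_zero_iff _).2 h3
      change x - b.range.starProjection x = x
      rw [h4, sub_zero]
    have := relRank_eq_of_surjective (A := a.ker) (B := b.range) f hf (fun x => by
      rw [← Subtype.coe_inj]
      change (x : E) - b.range.starProjection x = 0 ↔ _
      rw [sub_eq_zero, eq_comm, Submodule.starProjection_eq_self_iff])
    rw [lift_id, lift_id] at this
    rw [relRank_bot, this]
  -- (ker b)ᗮ lies in R(b*), hence in R(a + b*), so ker b already fills the cokernel.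
  have hr : relRank ⊤ (a + adjoint b).range = relRank b.ker a.range := by
    rw [← relRank_ker_range_add_adjoint hab hba]
    have hmap : (⊤ : Submodule 𝕜 F).map (a + adjoint b).range.mkQ =
        b.ker.map (a + adjoint b).range.mkQ := by
      refine le_antisymm ?_ (Submodule.map_mono le_top)
      rintro _ ⟨y, -, rfl⟩
      refine ⟨b.ker.starProjection y, b.ker.starProjection_apply_mem y, ?_⟩
      have h1 : y - b.ker.starProjection y ∈ (a + adjoint b).range :=
        range_adjoint_le_range_add_adjoint hab (orthogonal_ker_le_range_adjoint b hb_cl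
          (b.ker.sub_starProjection_mem_orthogonal y))
      rw [Submodule.mkQ_apply, Submodule.mkQ_apply, eq_comm, Submodule.Quotient.eq]
      exact h1
    rw [relRank, hmap, relRank]
  have z1 : relRank (a + adjoint b).range ⊤ = 0 := relRank_eq_zero_of_le le_top
  have z2 : relRank b.range a.ker = 0 := relRank_eq_zero_of_le hb_le
  have z3 : relRank a.range b.ker = 0 := relRank_eq_zero_of_le ha_le
  refine ⟨⟨hk ▸ h.1.1, ?_⟩, ⟨?_, hr ▸ h.2.1⟩, ?_⟩
  · rw [relRank_bot_left]
    exact aleph0_pos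
  · rw [z1]
    exact aleph0_pos
  · simp only [relDim, pairIndex, hk, hr, relRank_bot_left, z1, z2, z3]
    simp
    ring

lemma approximable_add_adjoint {s : E →L[𝕜] F} {t : F →L[𝕜] E}
    (hs : ∀ ε > 0, ∃ S : E →L[𝕜] F, FiniteDimensional 𝕜 S.range ∧ ‖s - S‖ < ε)
    (ht : ∀ ε > 0, ∃ S : F →L[𝕜] E, FiniteDimensional 𝕜 S.range ∧ ‖t - S‖ < ε) :
    ∀ ε > 0, ∃ S : E →L[𝕜] F, FiniteDimensional 𝕜 S.range ∧ ‖(s + adjoint t) - S‖ < ε := by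
  intro ε hε
  obtain ⟨S, hS, hS'⟩ := hs (ε / 2) (by positivity)
  obtain ⟨T, hT, hT'⟩ := ht (ε / 2) (by positivity)
  refine ⟨S + adjoint T, finiteRange_add hS (finiteRange_adjoint T hT), ?_⟩
  have e : (s + adjoint t) - (S + adjoint T) = (s - S) + adjoint (t - T) := by
    rw [map_sub]
    abel
  rw [e]
  calc _ ≤ ‖s - S‖ + ‖adjoint (t - T)‖ := norm_add_le _ _
    _ = ‖s - S‖ + ‖t - T‖ := by rw [LinearIsometryEquiv.norm_map]
    _ < ε := by linarith

lemma isFredholmPair_of_complex {a' : E →L[𝕜] F} {b' : F →L[𝕜] E}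
    (hab : ∀ y, a (b y) = 0) (hba : ∀ x, b (a x) = 0)
    (hab' : ∀ y, a' (b' y) = 0) (hba' : ∀ x, b' (a' x) = 0)
    (h : IsFredholmPair (a : E →ₗ[𝕜] F) (b : F →ₗ[𝕜] E))
    (ha : ∀ ε > 0, ∃ S : E →L[𝕜] F, FiniteDimensional 𝕜 S.range ∧ ‖(a' - a) - S‖ < ε)
    (hb : ∀ ε > 0, ∃ S : F →L[𝕜] E, FiniteDimensional 𝕜 S.range ∧ ‖(b' - b) - S‖ < ε) :
    IsFredholmPair (a' : E →ₗ[𝕜] F) (b' : F →ₗ[𝕜] E) ∧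
      pairIndex (a' : E →ₗ[𝕜] F) (b' : F →ₗ[𝕜] E) =
        pairIndex (a : E →ₗ[𝕜] F) (b : F →ₗ[𝕜] E) := by
  have e1 : (a + adjoint b) + ((a' - a) + adjoint (b' - b)) = a' + adjoint b' := by
    rw [map_sub]
    abel
  have e2 : (b + adjoint a) + ((b' - b) + adjoint (a' - a)) = b' + adjoint a' := by
    rw [map_sub]
    abel
  obtain ⟨p1, p2, p3⟩ := fredholm_add_adjoint hab hba h
  -- The cokernel of b' + a'* controls ker a'/R(b'), just as that of a' + b'* controls ker b'/R(a').
  -- Neither bound presupposes closed ranges of a' and b'.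
  obtain ⟨q1, q2, -⟩ := fredholm_add_adjoint hba hab h.symm
  obtain ⟨-, r2, r3⟩ := fredholm_add_of_approximable _ _ p1 p2 (approximable_add_adjoint ha hb)
  obtain ⟨-, s2, -⟩ := fredholm_add_of_approximable _ _ q1 q2 (approximable_add_adjoint hb ha)
  rw [e1] at r2 r3
  rw [e2] at s2
  have h' : IsFredholmPair (a' : E →ₗ[𝕜] F) (b' : F →ₗ[𝕜] E) := by
    refine ⟨⟨?_, ?_⟩, ⟨?_, ?_⟩⟩
    · rw [← relRank_ker_range_add_adjoint hba' hab']
      exact (relRank_mono_left le_top _).trans_lt s2.2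
    · rw [relRank_eq_zero_of_le]
      · exact aleph0_pos
      · rintro _ ⟨y, rfl⟩
        exact hab' y
    · rw [← relRank_ker_range_add_adjoint hab' hba']
      exact (relRank_mono_left le_top _).trans_lt r2.2
    · rw [relRank_eq_zero_of_le]
      · exact aleph0_pos
      · rintro _ ⟨y, rfl⟩
        exact hba' y
  refine ⟨h', ?_⟩
  rw [← (fredholm_add_adjoint hab' hba' h').2.2, r3, p3]

end Complex

/-- A pair with finite rank compositions is a finite rank perturbation of a complex. -/
lemma exists_complex (a : E →L[𝕜] F) (b : F →L[𝕜] E)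
    (hab : FiniteDimensional 𝕜 (a ∘L b).range) (hba : FiniteDimensional 𝕜 (b ∘L a).range) :
    ∃ (c : E →L[𝕜] F) (d : F →L[𝕜] E), (∀ y, c (d y) = 0) ∧ (∀ x, d (c x) = 0) ∧
      FiniteDimensional 𝕜 (a - c).range ∧ FiniteDimensional 𝕜 (b - d).range := by
  -- First arrange ad = 0, then precompose a with the projection onto ker (da). That projection
  -- fixes R(d), so the first identity survives.
  let d : F →L[𝕜] E := b ∘L (a ∘L b).ker.starProjection
  have had : ∀ y, a (d y) = 0 := fun y => (a ∘L b).ker.starProjection_apply_mem y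
  have hbd : FiniteDimensional 𝕜 (b - d).range := finiteRange_comp_starProjection_ker_sub _ hab b
  have hda : FiniteDimensional 𝕜 (d ∘L a).range := by
    have e : ((d ∘L a : E →L[𝕜] E) : E →ₗ[𝕜] E) =
        ((b ∘L a : E →L[𝕜] E) : E →ₗ[𝕜] E) +
          (-((b - d : F →L[𝕜] E) : F →ₗ[𝕜] E)) ∘ₗ (a : E →ₗ[𝕜] F) := by
      ext x
      simp
    rw [e]
    refine finiteRange_add hba (finiteRange_comp_right ?_ _)
    rw [LinearMap.range_neg]
    exact hbd
  refine ⟨a ∘L (d ∘L a).ker.starProjection, d, fun y => ?_,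
    fun x => (d ∘L a).ker.starProjection_apply_mem x,
    finiteRange_comp_starProjection_ker_sub _ hda a, hbd⟩
  have hy : d y ∈ (d ∘L a).ker := by
    change d (a (d y)) = 0
    rw [had, map_zero]
  change a ((d ∘L a).ker.starProjection (d y)) = 0
  rw [Submodule.starProjection_eq_self_iff.2 hy, had]

/-- Compact perturbations preserve Fredholm pairs and their index, as long as the compositions
keep finite rank. -/
theorem isFredholmPair_of_compact_sub {a a' : E →L[𝕜] F} {b b' : F →L[𝕜] E}
    (h : IsFredholmPair (a : E →ₗ[𝕜] F) (b : F →ₗ[𝕜] E))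
    (ha : IsCompactOperator (a' - a)) (hb : IsCompactOperator (b' - b))
    (hab : relRank b'.range a'.ker < ℵ₀) (hba : relRank a'.range b'.ker < ℵ₀) :
    IsFredholmPair (a' : E →ₗ[𝕜] F) (b' : F →ₗ[𝕜] E) ∧
      pairIndex (a' : E →ₗ[𝕜] F) (b' : F →ₗ[𝕜] E) =
        pairIndex (a : E →ₗ[𝕜] F) (b : F →ₗ[𝕜] E) := by
  obtain ⟨c, d, hcd, hdc, hac, hbd⟩ := exists_complex a b
    ((finiteRange_comp_iff _ _).2 h.1.2) ((finiteRange_comp_iff _ _).2 h.2.2)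
  obtain ⟨c', d', hcd', hdc', hac', hbd'⟩ := exists_complex a' b'
    ((finiteRange_comp_iff _ _).2 hab) ((finiteRange_comp_iff _ _).2 hba)
  obtain ⟨h1, i1⟩ := h.of_finiteRange_sub (a' := (c : E →ₗ[𝕜] F)) (b' := (d : F →ₗ[𝕜] E))
    (finiteRange_sub_comm hac) (finiteRange_sub_comm hbd)
  obtain ⟨h2, i2⟩ := isFredholmPair_of_complex hcd hdc hcd' hdc' h1
    (approximable_sub_of_compact ha hac hac') (approximable_sub_of_compact hb hbd hbd')
  obtain ⟨h3, i3⟩ := h2.of_finiteRange_sub hac' hbd'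
  exact ⟨h3, i3.trans (i2.trans i1)⟩

end Pair

end HilbertChain

/-! ### Folding a chain into its even and odd parts -/

namespace HilbertChain

open Submodule Cardinal

section PiRelRank

universe u v w

variable {K : Type*} {ι : Type w} {X : Type u} {V : ι → Type v} [DivisionRing K] [Fintype ι]
  [AddCommGroup X] [Module K X] [∀ i, AddCommGroup (V i)] [∀ i, Module K (V i)]

/-- For product subspaces the quotient splits as the product of the coordinate quotients. -/
lemma relRank_pi (e : X ≃ₗ[K] ∀ i, V i) {A B : Submodule K X} {A' B' : ∀ i, Submodule K (V i)}
    (hA : ∀ x, x ∈ A ↔ ∀ i, e x i ∈ A' i) (hB : ∀ x, x ∈ B ↔ ∀ i, e x i ∈ B' i) :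
    (relRank A B < ℵ₀ ↔ ∀ i, relRank (A' i) (B' i) < ℵ₀) ∧
      ((∀ i, relRank (A' i) (B' i) < ℵ₀) →
        toNat (relRank A B) = ∑ i, toNat (relRank (A' i) (B' i))) := by
  let f : A →ₗ[K] ∀ i, (A' i).map (B' i).mkQ :=
    LinearMap.pi fun i => ((B' i).mkQ ∘ₗ LinearMap.proj i ∘ₗ (e : X →ₗ[K] ∀ i, V i) ∘ₗ
      A.subtype).codRestrict _ (fun x => ⟨e x i, (hA x).1 x.2 i, rfl⟩)
  have hf : Function.Surjective f := by
    intro y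
    choose z hz hzy using fun i => (y i).2
    refine ⟨⟨e.symm z, (hA _).2 fun i => by simpa using hz i⟩, ?_⟩
    funext i
    refine Subtype.ext ?_
    rw [← hzy i]
    change (B' i).mkQ (e (e.symm z) i) = _
    rw [e.apply_symm_apply]
  have hker : ∀ x : A, f x = 0 ↔ (x : X) ∈ B := by
    intro x
    rw [hB, funext_iff]
    refine forall_congr' fun i => ?_
    rw [← Subtype.coe_inj, ← Submodule.Quotient.mk_eq_zero]
    rfl
  have h := relRank_eq_of_surjective f hf hker
  have hfin : relRank A B < ℵ₀ ↔ Module.Finite K (∀ i, (A' i).map (B' i).mkQ) := by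
    rw [← Module.rank_lt_aleph0_iff, ← lift_lt_aleph0.{u, max w v}, h, lift_lt_aleph0]
  refine ⟨?_, fun hi => ?_⟩
  · rw [hfin]
    constructor
    · intro _ i
      rw [relRank, Module.rank_lt_aleph0_iff]
      exact Module.Finite.of_surjective
        (LinearMap.proj (φ := fun i => (A' i).map (B' i).mkQ) (R := K) i)
        (LinearMap.proj_surjective i)
    · intro hi
      have : ∀ i, Module.Finite K ((A' i).map (B' i).mkQ) :=
        fun i => Module.rank_lt_aleph0_iff.1 (hi i)
      infer_instance
  · have : ∀ i, Module.Finite K ((A' i).map (B' i).mkQ) :=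
      fun i => Module.rank_lt_aleph0_iff.1 (hi i)
    have h2 := congrArg Cardinal.toNat h
    rw [toNat_lift, toNat_lift] at h2
    rw [h2]
    exact Module.finrank_pi_fintype K

lemma isCommensurable_pi (e : X ≃ₗ[K] ∀ i, V i) {A B : Submodule K X}
    {A' B' : ∀ i, Submodule K (V i)}
    (hA : ∀ x, x ∈ A ↔ ∀ i, e x i ∈ A' i) (hB : ∀ x, x ∈ B ↔ ∀ i, e x i ∈ B' i) :
    (IsCommensurable A B ↔ ∀ i, IsCommensurable (A' i) (B' i)) ∧
      ((∀ i, IsCommensurable (A' i) (B' i)) → relDim A B = ∑ i, relDim (A' i) (B' i)) := by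
  obtain ⟨h1, h2⟩ := relRank_pi e hA hB
  obtain ⟨h3, h4⟩ := relRank_pi e hB hA
  refine ⟨⟨fun h i => ⟨h1.1 h.1 i, h3.1 h.2 i⟩,
    fun h => ⟨h1.2 fun i => (h i).1, h3.2 fun i => (h i).2⟩⟩, fun h => ?_⟩
  simp only [relDim, Finset.sum_sub_distrib]
  rw [h2 fun i => (h i).1, h4 fun i => (h i).2]
  push_cast
  rfl

end PiRelRank

lemma isCompactOperator_pi {ι X : Type*} [Fintype ι] {Y : ι → Type*} [TopologicalSpace X] [Zero X]
    [∀ i, TopologicalSpace (Y i)] {f : X → ∀ i, Y i}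
    (h : ∀ i, IsCompactOperator fun x => f x i) : IsCompactOperator f := by
  choose C hC hCf using h
  refine ⟨Set.univ.pi C, isCompact_univ_pi hC, ?_⟩
  have : f ⁻¹' Set.univ.pi C = ⋂ i, (fun x => f x i) ⁻¹' C i := by
    ext x
    simp
  rw [this]
  exact Filter.iInter_mem.2 hCf

lemma sum_range_two_mul_neg_one_pow (r : ℕ → ℤ) (m : ℕ) :
    ∑ p ∈ Finset.range (2 * m), (-1) ^ p * r p =
      ∑ i ∈ Finset.range m, r (2 * i) - ∑ i ∈ Finset.range m, r (2 * i + 1) := by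
  induction m with
  | zero => simp
  | succ m ih =>
    rw [Finset.sum_range_succ _ m, Finset.sum_range_succ _ m, Nat.mul_succ, Finset.sum_range_succ,
      Finset.sum_range_succ, ih]
    simp [pow_succ]
    ring

section Fold

variable {𝕜 : Type*} [RCLike 𝕜] {H : ℕ → Type*}
  [∀ p, NormedAddCommGroup (H p)] [∀ p, InnerProductSpace 𝕜 (H p)]

variable (H) in
/-- The Hilbert sum of the even terms `H_0, H_2, …, H_{2m-2}`. -/
abbrev EvenSum (m : ℕ) := PiLp 2 fun i : Fin m => H (2 * i)

variable (H) in
/-- The Hilbert sum of the odd terms `H_1, H_3, …, H_{2m-1}`. -/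
abbrev OddSum (m : ℕ) := PiLp 2 fun i : Fin m => H (2 * i + 1)

variable (𝕜 H) in
/-- The coordinate in `H_{2j}`, which is zero for `j ≥ m`. -/
noncomputable def evenCoord (m j : ℕ) : EvenSum H m →L[𝕜] H (2 * j) :=
  if h : j < m then PiLp.proj 2 (fun i : Fin m => H (2 * i)) ⟨j, h⟩ else 0

/-- The part of a chain which maps even terms to odd terms. -/
noncomputable def evenToOdd (m : ℕ) (δ : ∀ p, H (p + 1) →L[𝕜] H p) :
    EvenSum H m →L[𝕜] OddSum H m :=
  ((PiLp.continuousLinearEquiv 2 𝕜 fun i : Fin m => H (2 * i + 1)).symm :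
      (∀ i : Fin m, H (2 * i + 1)) →L[𝕜] OddSum H m) ∘L
    -- The coordinate space H_{2(i+1)} is definitionally the source of `δ (2 * i + 1)`; for i = m -
    -- 1 the coordinate is the default 0.
    ContinuousLinearMap.pi fun i : Fin m => δ (2 * i + 1) ∘L evenCoord 𝕜 H m (i + 1)

/-- The part of a chain which maps odd terms to even terms. -/
noncomputable def oddToEven (m : ℕ) (δ : ∀ p, H (p + 1) →L[𝕜] H p) :
    OddSum H m →L[𝕜] EvenSum H m :=
  ((PiLp.continuousLinearEquiv 2 𝕜 fun i : Fin m => H (2 * i)).symm :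
      (∀ i : Fin m, H (2 * i)) →L[𝕜] EvenSum H m) ∘L
    ContinuousLinearMap.pi fun i : Fin m =>
      δ (2 * i) ∘L PiLp.proj 2 (fun i : Fin m => H (2 * i + 1)) i

variable {m : ℕ} (δ : ∀ p, H (p + 1) →L[𝕜] H p)

lemma evenToOdd_apply (x : EvenSum H m) (i : Fin m) :
    evenToOdd m δ x i = δ (2 * i + 1) (evenCoord 𝕜 H m (i + 1) x) := rfl

lemma oddToEven_apply (y : OddSum H m) (i : Fin m) :
    oddToEven m δ y i = δ (2 * i) (y i) := rfl

lemma evenCoord_of_lt {j : ℕ} (h : j < m) (x : EvenSum H m) :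
    evenCoord 𝕜 H m j x = x ⟨j, h⟩ := by
  rw [evenCoord, dif_pos h]
  rfl

lemma evenCoord_of_le {j : ℕ} (h : m ≤ j) (x : EvenSum H m) :
    evenCoord 𝕜 H m j x = 0 := by
  rw [evenCoord, dif_neg h.not_gt]
  rfl

lemma mem_ker_evenToOdd (x : EvenSum H m) :
    x ∈ (evenToOdd m δ).ker ↔ ∀ i : Fin m, x i ∈ nullSpace δ (2 * i) := by
  constructor
  · rintro hx ⟨_ | j, hj⟩
    · exact Submodule.mem_top
    · have h : evenToOdd m δ x ⟨j, by omega⟩ = 0 := by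
        rw [show evenToOdd m δ x = 0 from hx]
        rfl
      rw [evenToOdd_apply, evenCoord_of_lt hj] at h
      exact h
  · intro hx
    refine LinearMap.mem_ker.2 (PiLp.ext fun i => ?_)
    change evenToOdd m δ x i = 0
    rw [evenToOdd_apply]
    by_cases hi : (i : ℕ) + 1 < m
    · rw [evenCoord_of_lt hi]
      exact hx ⟨i + 1, hi⟩
    · rw [evenCoord_of_le (not_lt.1 hi), map_zero]

lemma mem_ker_oddToEven (y : OddSum H m) :
    y ∈ (oddToEven m δ).ker ↔ ∀ i : Fin m, y i ∈ nullSpace δ (2 * i + 1) := by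
  constructor
  · intro hy i
    have h : oddToEven m δ y i = 0 := by
      rw [show oddToEven m δ y = 0 from hy]
      rfl
    exact h
  · intro hy
    exact LinearMap.mem_ker.2 (PiLp.ext fun i => hy i)

lemma mem_range_oddToEven (x : EvenSum H m) :
    x ∈ (oddToEven m δ).range ↔ ∀ i : Fin m, x i ∈ rangeSpace δ (2 * i) := by
  constructor
  · rintro ⟨y, rfl⟩ i
    exact ⟨y i, rfl⟩
  · intro hx
    choose y hy using hx
    exact ⟨WithLp.toLp 2 y, PiLp.ext fun i => hy i⟩

lemma mem_range_evenToOdd (hm : Subsingleton (H (2 * m))) (y : OddSum H m) :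
    y ∈ (evenToOdd m δ).range ↔ ∀ i : Fin m, y i ∈ rangeSpace δ (2 * i + 1) := by
  constructor
  · rintro ⟨x, rfl⟩ i
    exact ⟨_, rfl⟩
  · intro hy
    choose x hx using hy
    -- Preimages shift up one slot. Slot 0 is free, and the preimage in H_{2m} is dropped because
    -- that space is zero.
    let z : ∀ i : Fin m, H (2 * i)
      | ⟨0, _⟩ => 0
      | ⟨j + 1, hj⟩ => x ⟨j, by omega⟩
    refine ⟨WithLp.toLp 2 z, PiLp.ext fun i => ?_⟩
    change evenToOdd m δ (WithLp.toLp 2 z) i = y i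
    rw [evenToOdd_apply, ← hx i]
    by_cases hi : (i : ℕ) + 1 < m
    · rw [evenCoord_of_lt hi]
      rfl
    · obtain ⟨i, hi'⟩ := i
      obtain rfl : m = i + 1 := by simp at hi; omega
      exact congrArg (δ (2 * i + 1)) (hm.elim _ _)

lemma evenToOdd_sub (δ' : ∀ p, H (p + 1) →L[𝕜] H p) :
    evenToOdd m (fun p => δ p + δ' p) - evenToOdd m δ = evenToOdd m δ' := by
  ext x i
  change evenToOdd m (fun p => δ p + δ' p) x i - evenToOdd m δ x i = evenToOdd m δ' x i
  simp only [evenToOdd_apply]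
  simp

lemma oddToEven_sub (δ' : ∀ p, H (p + 1) →L[𝕜] H p) :
    oddToEven m (fun p => δ p + δ' p) - oddToEven m δ = oddToEven m δ' := by
  ext x i
  change oddToEven m (fun p => δ p + δ' p) x i - oddToEven m δ x i = oddToEven m δ' x i
  simp only [oddToEven_apply]
  simp

lemma isCompactOperator_evenToOdd (h : ∀ p, IsCompactOperator (δ p)) :
    IsCompactOperator (evenToOdd m δ) := by
  have hpi : IsCompactOperator (ContinuousLinearMap.pi fun i : Fin m =>
      δ (2 * i + 1) ∘L evenCoord 𝕜 H m (i + 1)) :=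
    isCompactOperator_pi fun i => (h (2 * i + 1)).comp_clm (evenCoord 𝕜 H m (i + 1))
  exact hpi.clm_comp ((PiLp.continuousLinearEquiv 2 𝕜 fun i : Fin m => H (2 * i + 1)).symm :
      (∀ i : Fin m, H (2 * i + 1)) →L[𝕜] OddSum H m)

lemma isCompactOperator_oddToEven (h : ∀ p, IsCompactOperator (δ p)) :
    IsCompactOperator (oddToEven m δ) := by
  have hpi : IsCompactOperator (ContinuousLinearMap.pi fun i : Fin m =>
      δ (2 * i) ∘L PiLp.proj 2 (fun i : Fin m => H (2 * i + 1)) i) :=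
    isCompactOperator_pi fun i =>
      (h (2 * i)).comp_clm (PiLp.proj 2 (fun i : Fin m => H (2 * i + 1)) i)
  exact hpi.clm_comp ((PiLp.continuousLinearEquiv 2 𝕜 fun i : Fin m => H (2 * i)).symm :
      (∀ i : Fin m, H (2 * i)) →L[𝕜] EvenSum H m)

lemma isFredholmPair_fold (hm : Subsingleton (H (2 * m))) :
    (IsFredholmPair (evenToOdd m δ : EvenSum H m →ₗ[𝕜] OddSum H m)
        (oddToEven m δ : OddSum H m →ₗ[𝕜] EvenSum H m) ↔
      ∀ p < 2 * m, IsCommensurable (nullSpace δ p) (rangeSpace δ p)) ∧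
    ((∀ p < 2 * m, IsCommensurable (nullSpace δ p) (rangeSpace δ p)) →
      pairIndex (evenToOdd m δ : EvenSum H m →ₗ[𝕜] OddSum H m)
        (oddToEven m δ : OddSum H m →ₗ[𝕜] EvenSum H m) =
      ∑ p ∈ Finset.range (2 * m), (-1) ^ p * relDim (nullSpace δ p) (rangeSpace δ p)) := by
  obtain ⟨h1, h2⟩ := isCommensurable_pi (WithLp.linearEquiv 2 𝕜 (∀ i : Fin m, H (2 * i)))
    (mem_ker_evenToOdd δ) (mem_range_oddToEven δ)
  obtain ⟨h3, h4⟩ := isCommensurable_pi (WithLp.linearEquiv 2 𝕜 (∀ i : Fin m, H (2 * i + 1)))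
    (mem_ker_oddToEven δ) (mem_range_evenToOdd δ hm)
  refine ⟨⟨fun h p hp => ?_, fun h => ⟨h1.2 fun i => h _ (by omega), h3.2 fun i => h _ (by omega)⟩⟩,
    fun h => ?_⟩
  · obtain ⟨j, rfl | rfl⟩ := p.even_or_odd'
    · exact h1.1 h.1 ⟨j, by omega⟩
    · exact h3.1 h.2 ⟨j, by omega⟩
  · rw [pairIndex, h2 fun i => h _ (by omega), h4 fun i => h _ (by omega)]
    let r : ℕ → ℤ := fun p => relDim (nullSpace δ p) (rangeSpace δ p)
    change ∑ i : Fin m, r (2 * i) - ∑ i : Fin m, r (2 * i + 1) =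
      ∑ p ∈ Finset.range (2 * m), (-1) ^ p * r p
    rw [Fin.sum_univ_eq_sum_range (fun i => r (2 * i)),
      Fin.sum_univ_eq_sum_range (fun i => r (2 * i + 1))]
    exact (sum_range_two_mul_neg_one_pow r m).symm

end Fold

/-! ### Fredholm chains in terms of commensurability -/

section Chain

variable {𝕜 : Type*} [RCLike 𝕜] {H : ℕ → Type*}
  [∀ p, NormedAddCommGroup (H p)] [∀ p, InnerProductSpace 𝕜 (H p)]
  (δ : ∀ p, H (p + 1) →L[𝕜] H p)

lemma rank_nullQuotient (p : ℕ) :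
    Module.rank 𝕜 (NullQuotient δ p) = relRank (nullSpace δ p) (rangeSpace δ p) :=
  (relRank_eq_rank_quotient _ _).symm

lemma rank_rangeQuotient (p : ℕ) :
    Module.rank 𝕜 (RangeQuotient δ p) = relRank (rangeSpace δ p) (nullSpace δ p) := by
  rw [relRank_eq_rank_quotient, inf_comm (rangeSpace δ p)]

lemma finiteDimensional_quotients_iff (p : ℕ) :
    FiniteDimensional 𝕜 (NullQuotient δ p) ∧ FiniteDimensional 𝕜 (RangeQuotient δ p) ↔
      IsCommensurable (nullSpace δ p) (rangeSpace δ p) := by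
  rw [FiniteDimensional, FiniteDimensional, ← Module.rank_lt_aleph0_iff,
    ← Module.rank_lt_aleph0_iff, rank_nullQuotient, rank_rangeQuotient]
  exact ⟨fun h => ⟨h.1, h.2⟩, fun h => ⟨h.1, h.2⟩⟩

lemma index_eq_sum_relDim (n : ℕ) :
    index n δ = ∑ p ∈ Finset.range (n + 1),
      (-1) ^ p * relDim (nullSpace δ p) (rangeSpace δ p) := by
  simp only [index, Module.finrank, rank_nullQuotient, rank_rangeQuotient, relDim]

lemma relRank_of_subsingleton {K V : Type*} [DivisionRing K] [AddCommGroup V] [Module K V]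
    [Subsingleton V] (A B : Submodule K V) : relRank A B = 0 :=
  relRank_eq_zero_of_le (Subsingleton.elim A B).le

/-- Padding by zero spaces pairs each even degree with an odd one, as folding requires. -/
lemma index_eq_sum_range_two_mul {n : ℕ} (h : ∀ p, n < p → Subsingleton (H p)) :
    index n δ = ∑ p ∈ Finset.range (2 * (n + 1)),
      (-1) ^ p * relDim (nullSpace δ p) (rangeSpace δ p) := by
  rw [index_eq_sum_relDim]
  refine Finset.sum_subset (Finset.range_mono (by omega)) fun p _ hp => ?_
  have := h p (by simpa using hp)
  simp [relDim, relRank_of_subsingleton]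

lemma isCommensurable_of_lt {n p : ℕ} (h : ∀ p, n < p → Subsingleton (H p)) (hp : n < p) :
    IsCommensurable (nullSpace δ p) (rangeSpace δ p) := by
  have := h p hp
  constructor <;> rw [relRank_of_subsingleton] <;> exact aleph0_pos

lemma isFredholmChain_iff (n : ℕ) :
    IsFredholmChain n δ ↔ (∀ p, n < p → Subsingleton (H p)) ∧
      ∀ p, IsCommensurable (nullSpace δ p) (rangeSpace δ p) := by
  constructor
  · intro h
    refine ⟨h.1, fun p => ?_⟩
    by_cases hp : p ≤ n
    · exact (finiteDimensional_quotients_iff δ p).1 ⟨h.2 p hp, h.3 p hp⟩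
    · exact isCommensurable_of_lt δ h.1 (not_le.1 hp)
  · rintro ⟨h1, h2⟩
    exact ⟨h1, fun p _ => ((finiteDimensional_quotients_iff δ p).2 (h2 p)).1,
      fun p _ => ((finiteDimensional_quotients_iff δ p).2 (h2 p)).2⟩

lemma relRank_rangeSpace_nullSpace_lt
    (h : ∀ p, FiniteDimensional 𝕜 (LinearMap.range
      (((δ p).comp (δ (p + 1)) : H (p + 1 + 1) →L[𝕜] H p) : H (p + 1 + 1) →ₗ[𝕜] H p))) :
    ∀ p, relRank (rangeSpace δ p) (nullSpace δ p) < ℵ₀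
  | 0 => by
    rw [relRank_eq_zero_of_le (show rangeSpace δ 0 ≤ nullSpace δ 0 from le_top)]
    exact aleph0_pos
  | p + 1 => (finiteRange_comp_iff _ _).1 (h p)

end Chain

end HilbertChain

open HilbertChain Submodule in
theorem theorem6p6 {𝕜 : Type*} [RCLike 𝕜] {H : ℕ → Type*}
    [∀ p, NormedAddCommGroup (H p)] [∀ p, InnerProductSpace 𝕜 (H p)] [∀ p, CompleteSpace (H p)]
    (n : ℕ) (δ k : ∀ p, H (p + 1) →L[𝕜] H p)
    (hδ : HilbertChain.IsFredholmChain n δ)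
    (hk : ∀ p, IsCompactOperator (k p))
    (hfin : ∀ p, FiniteDimensional 𝕜
      (LinearMap.range
        (((δ p + k p).comp (δ (p + 1) + k (p + 1)) : H (p + 1 + 1) →L[𝕜] H p) :
          H (p + 1 + 1) →ₗ[𝕜] H p))) :
    HilbertChain.IsFredholmChain n (fun p => δ p + k p) ∧
      HilbertChain.index n δ = HilbertChain.index n (fun p => δ p + k p) := by
  obtain ⟨hsub, hcom⟩ := (isFredholmChain_iff δ n).1 hδ
  -- Folding with m = n + 1 covers all degrees up to n and leaves H_{2m} = 0.
  have hm : Subsingleton (H (2 * (n + 1))) := hsub _ (by omega)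
  set δ' : ∀ p, H (p + 1) →L[𝕜] H p := fun p => δ p + k p
  obtain ⟨f1, f2⟩ := isFredholmPair_fold δ hm
  obtain ⟨g1, g2⟩ := isFredholmPair_fold δ' hm
  have hr := relRank_rangeSpace_nullSpace_lt δ' hfin
  have hab := (relRank_pi (WithLp.linearEquiv 2 𝕜 (∀ i : Fin (n + 1), H (2 * i)))
    (mem_range_oddToEven δ') (mem_ker_evenToOdd δ')).1.2 fun i => hr _
  have hba := (relRank_pi (WithLp.linearEquiv 2 𝕜 (∀ i : Fin (n + 1), H (2 * i + 1)))
    (mem_range_evenToOdd δ' hm) (mem_ker_oddToEven δ')).1.2 fun i => hr _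
  have ha : IsCompactOperator (evenToOdd (n + 1) δ' - evenToOdd (n + 1) δ) := by
    rw [evenToOdd_sub]
    exact isCompactOperator_evenToOdd k hk
  have hb : IsCompactOperator (oddToEven (n + 1) δ' - oddToEven (n + 1) δ) := by
    rw [oddToEven_sub]
    exact isCompactOperator_oddToEven k hk
  obtain ⟨hp, hi⟩ := isFredholmPair_of_compact_sub (f1.2 fun p _ => hcom p) ha hb hab hba
  have hcom' := g1.1 hp
  refine ⟨(isFredholmChain_iff δ' n).2 ⟨hsub, fun p => ?_⟩, ?_⟩
  · by_cases hpn : n < p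
    · exact isCommensurable_of_lt δ' hsub hpn
    · exact hcom' p (by omega)
  · rw [index_eq_sum_range_two_mul δ hsub, index_eq_sum_range_two_mul δ' hsub,
      ← f2 fun p _ => hcom p, ← g2 hcom', hi]
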